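/- For an integer $t\ge 0$ let $$\mathcal{U}_{2t}(2;q):=\sum_{1\le k_1<\cdots<k_t}\ \prod_{i=1}^{t}\frac{q^{k_i}}{1+2q^{k_i}+q^{2k_i}}=\sum_{1\le k_1<\cdots<k_t}\frac{q^{k_1+\cdots+k_t}}{(1+q^{k_1})^2\cdots(1+q^{k_t})^2}\in\mathbb{Z}[[q]],$$ where $k_1,\dots,k_t$ are integers and $\mathcal{U}_0(2;q)=1$. These sums, and the sum $\sum_{t\ge0}\mathcal{U}_{2t}(2;q)$, converge coefficientwise as formal power series. Define integers $y(n)$ by $\sum_{n\ge0}y(n)\,q^n:=\sum_{t\ge0}\mathcal{U}_{2t}(2;q)$. Then, for every integer $n\ge0$, $$y(n)\equiv(-1)^n\cdot\#\{(r,s)\in\mathbb{Z}^2:\ n=r^2+s^2\}\pmod 5.$$ -/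

import Mathlib

open scoped PowerSeries PowerSeries.WithPiTopology

namespace MacMahonSums

/-- The formal power series `1 + a q^k + q^(2k)` with integer coefficients, for `k ≥ 1`. -/
noncomputable def denom (a : ℤ) (k : ℕ+) : ℤ⟦X⟧ :=
  1 + PowerSeries.C a * PowerSeries.X ^ (k : ℕ) + PowerSeries.X ^ (2 * (k : ℕ))

/-- The quotient `q^k / (1 + a q^k + q^(2k))` in the ring of formal power series over `ℤ`. -/
noncomputable def factor (a : ℤ) (k : ℕ+) : ℤ⟦X⟧ :=
  PowerSeries.X ^ (k : ℕ) * PowerSeries.invOfUnit (denom a k) 1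

/-- `factor a k` is the quotient that it is meant to be: the denominator has constant
coefficient `1`. -/
theorem factor_mul_denom (a : ℤ) (k : ℕ+) :
    factor a k * denom a k = PowerSeries.X ^ (k : ℕ) := by
  have h : PowerSeries.constantCoeff (denom a k) = ((1 : ℤˣ) : ℤ) := by
    simp [denom, k.ne_zero]
  rw [factor, mul_assoc, PowerSeries.invOfUnit_mul _ _ h, mul_one]

/-- For a finite set `S = {k₁ < ⋯ < k_t}` of positive integers, the summand
`q^(k₁ + ⋯ + k_t) / ((1 + a q^k₁ + q^(2k₁)) ⋯ (1 + a q^k_t + q^(2k_t)))`. -/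
noncomputable def summand (a : ℤ) (S : Finset ℕ+) : ℤ⟦X⟧ :=
  ∏ k ∈ S, factor a k

/-- The MacMahon-type series `𝒰_{2t}(a; q)`: the sum over all `1 ≤ k₁ < ⋯ < k_t` (that is, over
all `t`-element sets of positive integers) of
`q^(k₁ + ⋯ + k_t) / ((1 + a q^k₁ + q^(2k₁)) ⋯ (1 + a q^k_t + q^(2k_t)))`,
where the infinite sum converges coefficientwise. The case `a = -2` is MacMahon's `𝒰_{2t}(q)`. -/
noncomputable def U (a : ℤ) (t : ℕ) : ℤ⟦X⟧ :=
  ∑' S : {S : Finset ℕ+ // S.card = t}, summand a S.1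

end MacMahonSums

/-!
Expanding the product shows that the sum of all `U a t` is
`∏ (1 + q^k / (1 + a q^k + q^(2k))) = ∏ (1 + (a + 1) q^k + q^(2k)) / (1 + a q^k + q^(2k))`. For
`a = 2` the denominators are `(1 + q^k)²` and, since `3 ≡ -2` modulo `5`, the numerators are
congruent to `(1 - q^k)²`. Gauss' identity `∏ (1 - q^k) / (1 + q^k) = ∑_{r ∈ ℤ} (-1)^r q^(r²)`
then turns the product into the square of a theta series. Gauss' identity itself is the limit of a
finite identity of Shanks, proved by telescoping.
-/

namespace MacMahonSums

open Filter Finset.HasAntidiagonal PowerSeries PowerSeries.WithPiTopology Topology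

section Shanks

variable {R : Type*} [CommRing R]

/-- The summand, cleared of denominators, of Shanks' finite form of Gauss' identity:
`(-1)^s x^(s(n+1)) (-1; x)_s (x^(s+1); x)_(n-s)` in the `q`-Pochhammer notation. -/
def shanksTerm (x : R) (n s : ℕ) : R :=
  (-1) ^ s * x ^ (s * (n + 1)) * (∏ i ∈ Finset.range s, (1 + x ^ i)) *
    ∏ i ∈ Finset.Ico (s + 1) (n + 1), (1 - x ^ i)

/-- The sequence whose differences in `s` are the increments of `shanksTerm` from `n` to `n + 1`:
`(-1)^s x^(s(n+1)) (-1; x)_s (x^s; x)_(n+1-s)` in the `q`-Pochhammer notation. -/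
def shanksPotential (x : R) (n s : ℕ) : R :=
  (-1) ^ s * x ^ (s * (n + 1)) * (∏ i ∈ Finset.range s, (1 + x ^ i)) *
    ∏ i ∈ Finset.Ico s (n + 1), (1 - x ^ i)

theorem shanksTerm_succ_sub (x : R) {n s : ℕ} (h : s ≤ n) :
    shanksTerm x (n + 1) s - (1 + x ^ (n + 1)) * shanksTerm x n s =
      shanksPotential x n (s + 1) - shanksPotential x n s := by
  rw [shanksTerm, shanksTerm, shanksPotential, shanksPotential,
    Finset.prod_Ico_succ_top (by lia),
    Finset.prod_eq_prod_Ico_succ_bot (show s < n + 1 by lia), Finset.prod_range_succ]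
  ring

theorem shanksPotential_zero (x : R) (n : ℕ) : shanksPotential x n 0 = 0 :=
  mul_eq_zero_of_right _
    (Finset.prod_eq_zero (Finset.mem_Ico.mpr ⟨le_rfl, n.succ_pos⟩) (by simp))

theorem shanksTerm_zero (x : R) (n : ℕ) :
    shanksTerm x n 0 = ∏ i ∈ Finset.range n, (1 - x ^ (i + 1)) := by
  rw [Finset.range_eq_Ico, Finset.prod_Ico_add' (fun i => 1 - x ^ i)]
  simp [shanksTerm]

theorem shanksTerm_self_add_shanksPotential (x : R) (n : ℕ) :
    shanksTerm x (n + 1) (n + 1) + shanksPotential x n (n + 1) =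
      2 * (-1) ^ (n + 1) * x ^ (n + 1) ^ 2 * ∏ i ∈ Finset.range (n + 1), (1 + x ^ (i + 1)) := by
  have h : (∏ i ∈ Finset.range (n + 1), (1 + x ^ i)) * (1 + x ^ (n + 1)) =
      2 * ∏ i ∈ Finset.range (n + 1), (1 + x ^ (i + 1)) := by
    rw [← Finset.prod_range_succ, Finset.prod_range_succ', pow_zero, one_add_one_eq_two, mul_comm]
  simp only [shanksTerm, shanksPotential, Finset.Ico_self, Finset.prod_empty]
  linear_combination (-1) ^ (n + 1) * x ^ (n + 1) ^ 2 * h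

theorem sum_shanksTerm (x : R) (n : ℕ) :
    ∑ s ∈ Finset.range (n + 1), shanksTerm x n s =
      (2 * ∑ j ∈ Finset.range (n + 1), (-1) ^ j * x ^ j ^ 2 - 1) *
        ∏ i ∈ Finset.range n, (1 + x ^ (i + 1)) := by
  induction n with
  | zero => norm_num [shanksTerm]
  | succ n ih =>
    have telescope : ∑ s ∈ Finset.range (n + 1), shanksTerm x (n + 1) s =
        (1 + x ^ (n + 1)) * ∑ s ∈ Finset.range (n + 1), shanksTerm x n s +
          shanksPotential x n (n + 1) := by
      rw [← sub_eq_iff_eq_add', Finset.mul_sum, ← Finset.sum_sub_distrib,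
        Finset.sum_congr rfl fun s hs =>
          shanksTerm_succ_sub x (Nat.le_of_lt_succ (Finset.mem_range.mp hs)),
        Finset.sum_range_sub, shanksPotential_zero, sub_zero]
    have last := shanksTerm_self_add_shanksPotential x n
    rw [Finset.prod_range_succ] at last ⊢
    rw [Finset.sum_range_succ, telescope, ih,
      Finset.sum_range_succ (fun j => (-1) ^ j * x ^ j ^ 2) (n + 1)]
    linear_combination last

theorem pow_dvd_sum_mul_prod_sub_prod (x : R) (n : ℕ) :
    x ^ (n + 1) ∣ (2 * ∑ j ∈ Finset.range (n + 1), (-1) ^ j * x ^ j ^ 2 - 1) *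
      ∏ i ∈ Finset.range n, (1 + x ^ (i + 1)) - ∏ i ∈ Finset.range n, (1 - x ^ (i + 1)) := by
  rw [← sum_shanksTerm, Finset.sum_range_succ', shanksTerm_zero, add_sub_cancel_right]
  refine Finset.dvd_sum fun s _ => ?_
  simp only [shanksTerm, mul_assoc]
  exact ((pow_dvd_pow x (Nat.le_mul_of_pos_left _ s.succ_pos)).mul_right _).mul_left _

end Shanks

section Topology

variable {R : Type*} [CommRing R]

theorem tendsto_order_of_X_pow_dvd {f : ℕ+ → R⟦X⟧} (h : ∀ k : ℕ+, X ^ (k : ℕ) ∣ f k) :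
    Tendsto (fun k => (f k).order) atTop (𝓝 ⊤) :=
  ENat.tendsto_nhds_top_iff_natCast_lt.mpr fun n =>
    eventually_atTop.mpr ⟨n.succPNat, fun k hk =>
      have hnk : n < (k : ℕ) := (PNat.coe_le_coe _ _).mpr hk
      (Nat.cast_lt.mpr hnk).trans_le (nat_le_order _ _ (X_pow_dvd_iff.mp (h k)))⟩

variable [TopologicalSpace R]

theorem multipliable_one_add_of_X_pow_dvd {f : ℕ+ → R⟦X⟧} (h : ∀ k : ℕ+, X ^ (k : ℕ) ∣ f k) :
    Multipliable fun k => 1 + f k :=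
  multipliable_one_add_of_tendsto_order_atTop_nhds_top R (tendsto_order_of_X_pow_dvd h)

variable (R) in
theorem multipliable_one_add_X_pow : Multipliable fun n : ℕ => 1 + (X : R⟦X⟧) ^ (n + 1) :=
  multipliable_pnat_iff_multipliable_succ (f := fun n => 1 + (X : R⟦X⟧) ^ n).mp
    (multipliable_one_add_of_X_pow_dvd fun _ => dvd_rfl)

theorem isUnit_tprod_one_add_X_pow [T2Space R] :
    IsUnit (∏' n : ℕ, (1 + (X : R⟦X⟧) ^ (n + 1))) := by
  rw [isUnit_iff_constantCoeff, (multipliable_one_add_X_pow R).map_tprod _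
    (continuous_constantCoeff R)]
  simp

theorem tendsto_zero_of_X_pow_dvd {f : ℕ → R⟦X⟧} (h : ∀ n, X ^ (n + 1) ∣ f n) :
    Tendsto f atTop (𝓝 0) :=
  (tendsto_iff_coeff_tendsto R _ _ _).mpr fun d =>
    tendsto_atTop_of_eventually_const (i₀ := d) fun n hn =>
      X_pow_dvd_iff.mp (h n) d (Nat.lt_succ_of_le hn)

theorem continuous_map {S : Type*} [CommRing S] [TopologicalSpace S] {f : R →+* S}
    (hf : Continuous f) : Continuous (PowerSeries.map f) :=
  continuous_pi fun d => hf.comp (continuous_apply d)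

end Topology

section Theta

variable (R : Type*) [CommRing R]

/-- The theta series `∑_{r ∈ ℤ} (-1)^r q^(r²)`, given by its coefficients so that no topology on
`R` is needed; the sign of the `n`-th one is `(-1)^n` because `r ≡ r²` modulo `2`. -/
noncomputable def thetaSeries : R⟦X⟧ :=
  PowerSeries.mk fun n => (-1) ^ n * ({r : ℤ | r.natAbs ^ 2 = n}.ncard : R)

theorem finite_natAbs_sq_eq (n : ℕ) : {r : ℤ | r.natAbs ^ 2 = n}.Finite :=
  (Set.finite_Icc (-(n : ℤ)) n).subset fun r (hr : r.natAbs ^ 2 = n) => by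
    have := Nat.le_self_pow two_ne_zero r.natAbs
    rw [Set.mem_Icc]
    lia

theorem hasSum_thetaSeries [TopologicalSpace R] :
    HasSum (fun r : ℤ => (-1) ^ r.natAbs * X ^ r.natAbs ^ 2) (thetaSeries R) := by
  refine (hasSum_iff_hasSum_coeff R).mpr fun n => ?_
  have hcoeff (r : ℤ) : coeff n ((-1 : R⟦X⟧) ^ r.natAbs * X ^ r.natAbs ^ 2) =
      if r.natAbs ^ 2 = n then (-1) ^ n else 0 := by
    rw [← map_one (C (R := R)), ← map_neg, ← map_pow, coeff_C_mul, coeff_X_pow]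
    split_ifs with h h' h'
    · rw [h, mul_one, neg_one_pow_congr]
      simp [Nat.even_pow]
    all_goals simp_all
  simp only [hcoeff]
  have hsupp := hasSum_sum_of_ne_finset_zero (L := .unconditional ℤ)
    (f := fun r : ℤ => if r.natAbs ^ 2 = n then (-1 : R) ^ n else 0)
    (s := (finite_natAbs_sq_eq n).toFinset) (by simp +contextual)
  convert hsupp using 1
  rw [Finset.sum_congr rfl fun r hr => if_pos (by simpa using hr), Finset.sum_const,
    ← Set.ncard_eq_toFinset_card _ (finite_natAbs_sq_eq n), thetaSeries, coeff_mk,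
    nsmul_eq_mul, mul_comm]

theorem tendsto_two_mul_sum_sub_one [TopologicalSpace R] [IsTopologicalRing R] :
    Tendsto (fun n => 2 * ∑ j ∈ Finset.range (n + 1), (-1) ^ j * (X : R⟦X⟧) ^ j ^ 2 - 1) atTop
      (𝓝 (thetaSeries R)) := by
  have h := ((hasSum_thetaSeries R).nat_add_neg.tendsto_sum_nat.comp
    (tendsto_add_atTop_nat 1)).sub_const 1
  simpa [Function.comp_def, ← two_mul, ← Finset.mul_sum] using h

variable {R} in
theorem thetaSeries_mul_tprod_one_add_X_pow [TopologicalSpace R] [IsTopologicalRing R]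
    [T2Space R] :
    thetaSeries R * ∏' n : ℕ, (1 + (X : R⟦X⟧) ^ (n + 1)) =
      ∏' n : ℕ, (1 - (X : R⟦X⟧) ^ (n + 1)) := by
  have hadd := (multipliable_one_add_X_pow R).tendsto_prod_tprod_nat
  have hsub := (multipliable_one_sub_X_pow R).tendsto_prod_tprod_nat
  exact sub_eq_zero.mp (tendsto_nhds_unique
    (((tendsto_two_mul_sum_sub_one R).mul hadd).sub hsub)
    (tendsto_zero_of_X_pow_dvd (pow_dvd_sum_mul_prod_sub_prod X)))

theorem ncard_add_eq {ι κ : Type*} {e : ι → ℕ} {f : κ → ℕ} (he : ∀ n, {i | e i = n}.Finite)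
    (hf : ∀ n, {j | f j = n}.Finite) (n : ℕ) :
    {p : ι × κ | e p.1 + f p.2 = n}.ncard =
      ∑ d ∈ antidiagonal n, {i | e i = d.1}.ncard * {j | f j = d.2}.ncard := by
  have hunion : {p : ι × κ | e p.1 + f p.2 = n} =
      ⋃ d ∈ (antidiagonal n : Set (ℕ × ℕ)), {i | e i = d.1} ×ˢ {j | f j = d.2} := by
    ext p
    simp
  have hdisj : (antidiagonal n : Set (ℕ × ℕ)).PairwiseDisjoint
      fun d => {i | e i = d.1} ×ˢ {j | f j = d.2} := fun d _ d' _ hne =>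
    Set.disjoint_left.mpr fun p hp hp' =>
      hne (Prod.ext (hp.1.symm.trans hp'.1) (hp.2.symm.trans hp'.2))
  rw [hunion, Set.Finite.ncard_biUnion (Finset.finite_toSet _)
    (fun d _ => (he d.1).prod (hf d.2)) hdisj, finsum_mem_coe_finset]
  simp only [Set.ncard_prod]

theorem coeff_thetaSeries_sq (n : ℕ) :
    coeff n (thetaSeries R ^ 2) =
      (-1) ^ n * ({p : ℤ × ℤ | (n : ℤ) = p.1 ^ 2 + p.2 ^ 2}.ncard : R) := by
  have hset : {p : ℤ × ℤ | (n : ℤ) = p.1 ^ 2 + p.2 ^ 2} =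
      {p : ℤ × ℤ | p.1.natAbs ^ 2 + p.2.natAbs ^ 2 = n} := by
    ext p
    simp only [Set.mem_ofPred_eq, eq_comm (a := (n : ℤ))]
    zify
    simp only [sq_abs]
  rw [hset, ncard_add_eq finite_natAbs_sq_eq finite_natAbs_sq_eq, Nat.cast_sum, Finset.mul_sum,
    sq, coeff_mul]
  refine Finset.sum_congr rfl fun d hd => ?_
  rw [thetaSeries, coeff_mk, coeff_mk, ← mem_antidiagonal.mp hd, pow_add, Nat.cast_mul]
  ring

end Theta

section MacMahon

theorem summable_summand (a : ℤ) : Summable (summand a) :=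
  summable_prod_of_tendsto_order_atTop_nhds_top ℤ
    (tendsto_order_of_X_pow_dvd fun _ => dvd_mul_right _ _)

theorem hasSum_U (a : ℤ) : HasSum (U a) (∏' k, (1 + factor a k)) := by
  rw [(hasProd_one_add_of_hasSum_prod (summable_summand a).hasSum).tprod_eq]
  exact (summable_summand a).hasSum.tsum_fiberwise Finset.card

theorem multipliable_denom (a : ℤ) : Multipliable (denom a) := by
  change Multipliable fun k => denom a k
  simp only [denom, add_assoc]
  refine multipliable_one_add_of_X_pow_dvd fun k => ?_
  exact (dvd_mul_left _ _).add (pow_dvd_pow X (by lia))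

theorem one_add_factor_mul_denom (a : ℤ) (k : ℕ+) :
    (1 + factor a k) * denom a k = denom (a + 1) k := by
  rw [one_add_mul, factor_mul_denom]
  simp only [denom, map_add, map_one]
  ring

theorem tprod_one_add_factor_mul_tprod_denom (a : ℤ) :
    (∏' k, (1 + factor a k)) * ∏' k, denom a k = ∏' k, denom (a + 1) k := by
  have hfactor : Multipliable fun k => 1 + factor a k :=
    multipliable_one_add_of_X_pow_dvd fun _ => dvd_mul_right _ _
  rw [← hfactor.tprod_mul (multipliable_denom a)]
  simp only [one_add_factor_mul_denom]

theorem map_denom (a : ℤ) (m : ℕ) (k : ℕ+) :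
    map (Int.castRingHom (ZMod m)) (denom a k) =
      1 + C (a : ZMod m) * X ^ (k : ℕ) + X ^ (2 * (k : ℕ)) := by
  simp [denom]

theorem map_tprod_denom_eq_sq {a : ℤ} {m : ℕ} {f : ℕ → (ZMod m)⟦X⟧}
    (hf : Multipliable fun n => f (n + 1))
    (h : ∀ k : ℕ+, map (Int.castRingHom (ZMod m)) (denom a k) = f k ^ 2) :
    map (Int.castRingHom (ZMod m)) (∏' k, denom a k) = (∏' n, f (n + 1)) ^ 2 := by
  rw [(multipliable_denom a).map_tprod _ (continuous_map continuous_of_discreteTopology)]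
  simp only [h]
  rw [tprod_pnat_eq_tprod_succ (f := fun n => f n ^ 2), hf.tprod_pow]

theorem map_tprod_denom_two (m : ℕ) :
    map (Int.castRingHom (ZMod m)) (∏' k, denom 2 k) =
      (∏' n : ℕ, (1 + (X : (ZMod m)⟦X⟧) ^ (n + 1))) ^ 2 := by
  refine map_tprod_denom_eq_sq (f := fun n => 1 + X ^ n) (multipliable_one_add_X_pow _) fun k => ?_
  rw [map_denom, Int.cast_ofNat, map_ofNat]
  ring

theorem map_tprod_denom_three :
    map (Int.castRingHom (ZMod 5)) (∏' k, denom 3 k) =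
      (∏' n : ℕ, (1 - (X : (ZMod 5)⟦X⟧) ^ (n + 1))) ^ 2 := by
  refine map_tprod_denom_eq_sq (f := fun n => 1 - X ^ n) (multipliable_one_sub_X_pow _) fun k => ?_
  have three_eq_neg_two : ((3 : ℤ) : ZMod 5) = -2 := rfl
  rw [map_denom, three_eq_neg_two, map_neg, map_ofNat]
  ring

theorem map_tprod_one_add_factor_two :
    map (Int.castRingHom (ZMod 5)) (∏' k, (1 + factor 2 k)) = thetaSeries (ZMod 5) ^ 2 := by
  refine (isUnit_tprod_one_add_X_pow (R := ZMod 5)).pow 2 |>.mul_right_cancel ?_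
  rw [← mul_pow, thetaSeries_mul_tprod_one_add_X_pow, ← map_tprod_denom_two, ← map_mul,
    tprod_one_add_factor_mul_tprod_denom, ← map_tprod_denom_three]
  norm_num

end MacMahon

end MacMahonSums

theorem theorem5p4 :
    (∀ t : ℕ, Summable fun S : {S : Finset ℕ+ // S.card = t} => MacMahonSums.summand 2 S.1) ∧
    (Summable fun t : ℕ => MacMahonSums.U 2 t) ∧
    ∀ y : ℕ → ℤ, HasSum (fun t : ℕ => MacMahonSums.U 2 t) (PowerSeries.mk y) →
      ∀ n : ℕ,
        y n ≡ (-1) ^ n * (Set.ncard {p : ℤ × ℤ | (n : ℤ) = p.1 ^ 2 + p.2 ^ 2} : ℤ) [ZMOD 5] := by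
  refine ⟨fun t => (MacMahonSums.summable_summand 2).comp_injective Subtype.val_injective,
    (MacMahonSums.hasSum_U 2).summable, fun y hy n => ?_⟩
  have hmk := MacMahonSums.map_tprod_one_add_factor_two
  rw [(MacMahonSums.hasSum_U 2).unique hy] at hmk
  have hcoeff := congrArg (PowerSeries.coeff n) hmk
  rw [PowerSeries.coeff_map, PowerSeries.coeff_mk, MacMahonSums.coeff_thetaSeries_sq] at hcoeff
  refine (ZMod.intCast_eq_intCast_iff _ _ 5).mp ?_
  push_cast
  exact hcoeff
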